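/- Let $\mathcal X$ be a set, and let $G_1,\dots,G_J:\mathcal X\to\mathcal X$ be commuting maps such that $G_j$ is $T_j$-cyclic ($T_j$ is the smallest positive integer with $G_j^{T_j}=\mathrm{id}$). Let $k:\mathcal X\times\mathcal X\to\mathbb C$ be a (Hermitian, positive semidefinite) kernel with $k(G_jx,G_jx')=k(x,x')$ for all $j,x,x'$. For multi-indices $t=(t_1,\dots,t_J)$ with $0\le t_j<T_j$ write $G^t=G_1^{t_1}\cdots G_J^{t_J}$, let $F_{t,s}=\prod_j T_j^{-1}e^{-2\pi i t_js_j/T_j}$ be the DFT matrix, and put $k_t(x,x')=\sum_s F_{t,s}\,k(x,G^s x')$. (The case $J=1$ is that of a single $T$-cyclic map with the $T\times T$ DFT matrix.) Let $T=\prod_jT_j$. Here $\mathcal{GP}(0,k)$ denotes the centred complex Gaussian process with $\mathbb E f(x)\overline{f(x')}=k(x,x')$, and $\mathcal N(\mu,S)$ the complex Gaussian law with mean $\mu$ and covariance $S$ (both circularly symmetric). Let $Z=(z_1,\dots,z_m)$ be inducing points in $\mathcal X$, shared by all subprocesses, such that the prior covariance matrix $[k(G^tz_i,G^{s}z_j)]_{(i,t),(j,s)}$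 of the values of $f$ at $\{G^t(Z)\}_t$ is nonsingular. Let $M_v\in\mathbb C^{T\times m}$, and let $S_v\in\mathbb C^{Tm\times Tm}$ be Hermitian positive semidefinite. Conditional laws $p(\cdot\mid\cdot)$ below are the versions that are (weakly) continuous in the conditioning value. Consider: 1. The SVGP with inducing points $\{G^t(Z)\}_t$: for the prior $f\sim\mathcal{GP}(0,k)$ and $V\in\mathbb C^{T\times m}$ with rows $v_t=f(G^t(Z))$, it is $q_{\mathrm{svgp}}(f(\cdot),V)=p(f(\cdot)\mid V)\,\mathcal N(\mathrm{vec}\,V\mid \mathrm{vec}\,M_v,S_v)$. 2. The harmonic variational posterior: for the priors $f_t\sim\mathcal{GP}(0,k_t)$ and $u_t=f_t(Z)$, with $U\in\mathbb C^{T\times m}$ having rows $u_t$, take $\mathrm{vec}\,U\sim\mathcal N\big(\mathrm{vec}(F^HM_v),(I\otimes F^H)S_v(I\otimes F)\big)$; given $U$, draw the $f_t(\cdot)\sim p_t(f_t(\cdot)\mid u_t)$ independently; and set $f=\sum_t f_t$. Then the marginal distributions of $f(\cdot)$ under the two variational posteriors are the same. Moreover, if $f_t\sim\mathcal{GP}(0,k_t)$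 are independent and $f=\sum_tf_t$, then $f\sim\mathcal{GP}(0,k)$ and almost surely $U=F^HV$, where $V\mapsto F^HV$ is a bijective linear map. -/

import Mathlib

open MeasureTheory ProbabilityTheory Matrix
open scoped MatrixOrder ComplexOrder Kronecker BoundedContinuousFunction

noncomputable section

namespace HVGP

/-! ### Complex Gaussian vectors and complex Gaussian processes -/

/-- The standard complex Gaussian law on `ℂ`: independent real and imaginary parts, each `N(0, 1/2)`,
so that the mean is `0`, `𝔼 |ξ|² = 1` and `𝔼 ξ² = 0`. -/
def stdComplexGaussian : Measure ℂ :=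
  ((gaussianReal 0 (1 / 2)).prod (gaussianReal 0 (1 / 2))).map fun p => (⟨p.1, p.2⟩ : ℂ)

open scoped Classical in
/-- The (circularly symmetric) complex Gaussian law `N(μ, S)` on `ℂ^ι` with mean `μ` and covariance
`S = 𝔼 (z - μ) (z - μ)ᴴ`, for `S` Hermitian positive semidefinite: the law of `μ + S^{1/2} ξ`, where
the coordinates of `ξ` are independent standard complex Gaussian variables. -/
def complexGaussian {ι : Type*} [Fintype ι] (μ : ι → ℂ) (S : Matrix ι ι ℂ) : Measure (ι → ℂ) :=
  (Measure.pi fun _ : ι => stdComplexGaussian).map fun ξ => μ + CFC.sqrt S *ᵥ ξ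

/-- The matrix `[k (xᵢ, yⱼ)]ᵢⱼ` of kernel values. -/
def kernelMatrix {X ι κ : Type*} (k : X → X → ℂ) (x : ι → X) (y : κ → X) : Matrix ι κ ℂ :=
  Matrix.of fun i j => k (x i) (y j)

/-- A complex-valued kernel: Hermitian and positive semidefinite on all finite sets of inputs. -/
def IsKernel {X : Type*} (k : X → X → ℂ) : Prop :=
  ∀ I : Finset X, (kernelMatrix k (fun i : I => (i : X)) (fun i : I => (i : X))).PosSemidef

/-- `P` is the law of the Gaussian process `GP(0, k)`: the values at finitely many inputs are
jointly Gaussian, with mean zero and covariance `𝔼 f(x) conj(f(x')) = k(x, x')`. -/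
def IsGPLaw {X : Type*} (k : X → X → ℂ) (P : Measure (X → ℂ)) : Prop :=
  ∀ I : Finset X, P.map I.restrict =
    complexGaussian 0 (kernelMatrix k (fun i : I => (i : X)) (fun i : I => (i : X)))

/-- `κ` is the conditional law `p(f(·) | Φ(f) = v)` of a random function `f ∼ P` given a random
vector `Φ(f)` of inducing variables. As conditional laws are only determined up to null sets of
values `v`, we take the version whose finite-dimensional laws are weakly continuous in `v`
(there is at most one if the law of `Φ(f)` has full support). -/
structure IsConditionalLaw {X ι : Type*} [Fintype ι] (P : Measure (X → ℂ))
    (Φ : (X → ℂ) → (ι → ℂ)) (κ : Kernel (ι → ℂ) (X → ℂ)) : Prop where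
  isMarkovKernel : IsMarkovKernel κ
  disintegration : (P.map Φ) ⊗ₘ κ = P.map fun f => (Φ f, f)
  continuous : ∀ (I : Finset X) (g : (I → ℂ) →ᵇ ℝ),
    Continuous fun v => ∫ f, g (I.restrict f) ∂(κ v)

/-! ### Harmonic kernel decomposition, for `J` commuting cyclic transformations -/

/-- `G` is `T`-cyclic: `T` is the smallest positive integer with `G^T = id`. -/
def IsCyclicMap {X : Type*} (T : ℕ) (G : X → X) : Prop :=
  IsLeast {n : ℕ | 0 < n ∧ G^[n] = id} T

/-- The multi-indices `t = (t₁, …, t_J)` with `0 ≤ t_j < T_j`. -/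
abbrev MultiIndex {J : ℕ} (T : Fin J → ℕ) : Type := ∀ j, Fin (T j)

/-- The composition `G^t = G₁^{t₁} ∘ ⋯ ∘ G_J^{t_J}`. -/
def iter {X : Type*} {J : ℕ} {T : Fin J → ℕ} (G : Fin J → X → X) (t : MultiIndex T) : X → X :=
  (List.ofFn fun j => (G j)^[(t j : ℕ)]).foldr (fun g h => g ∘ h) id

/-- The `T × T` DFT matrix `[T⁻¹ exp(-2πi t s / T)]`. -/
def dft (T : ℕ) : Matrix (Fin T) (Fin T) ℂ :=
  Matrix.of fun t s =>
    (1 / (T : ℂ)) * Complex.exp (-(Complex.I * (2 * Real.pi * (t : ℕ) * (s : ℕ) / T)))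

/-- The `J`-dimensional DFT matrix: the tensor product of the one-dimensional ones. -/
def multiDft {J : ℕ} (T : Fin J → ℕ) : Matrix (MultiIndex T) (MultiIndex T) ℂ :=
  Matrix.of fun t s => ∏ j, dft (T j) (t j) (s j)

/-- The kernel Fourier series: `k_t(x, x') = ∑ₛ F_{t,s} k(x, G^s x')`. -/
def fourierKernel {X : Type*} {J : ℕ} (T : Fin J → ℕ) (G : Fin J → X → X) (k : X → X → ℂ)
    (t : MultiIndex T) (x x' : X) : ℂ :=
  ∑ s, multiDft T t s * k x (iter G s x')

/-! ### Inducing variables and the two variational posteriors -/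

/-- The inducing variables `V` of the SVGP: row `t` is `v_t = f(G^t(Z))`. -/
def inducingV {X : Type*} {J m : ℕ} (T : Fin J → ℕ) (G : Fin J → X → X) (Z : Fin m → X)
    (f : X → ℂ) : Matrix (MultiIndex T) (Fin m) ℂ :=
  Matrix.of fun t i => f (iter G t (Z i))

/-- The inducing variables `U` of the subprocesses: row `t` is `u_t = f_t(Z)`. -/
def inducingU {X : Type*} {J m : ℕ} (T : Fin J → ℕ) (Z : Fin m → X)
    (f : MultiIndex T → X → ℂ) : Matrix (MultiIndex T) (Fin m) ℂ :=
  Matrix.of fun t i => f t (Z i)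

/-- The marginal law of `f(·)` under `q(f(·), V) = p(f(·) | V) q(V)`. -/
def svgpMarginal {X ι : Type*} (κ : Kernel (ι → ℂ) (X → ℂ)) (q : Measure (ι → ℂ)) :
    Measure (X → ℂ) :=
  q.bind fun v => κ v

/-- The marginal law of `f(·)` under the variational posterior of the decomposed process:
`vec U ∼ q`; given `U`, the subprocesses are independent with `f_t(·) ∼ p_t(f_t(·) | u_t)`;
and `f = ∑ₜ f_t`. -/
def harmonicMarginal {X : Type*} {J m : ℕ} (T : Fin J → ℕ)
    (κ : MultiIndex T → Kernel (Fin m → ℂ) (X → ℂ)) (q : Measure (Fin m × MultiIndex T → ℂ)) :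
    Measure (X → ℂ) :=
  q.bind fun u => (Measure.pi fun t => κ t fun i => u (i, t)).map fun f => ∑ t, f t

end HVGP

end

open HVGP

/-! Write `χ_t(a)` for the characters and `N = ∏ T_j`. Invariance of `k` gives `k_t(G^a x, x') =
χ_t(a) k_t(x, x')`, so `f_t(G^a x) - χ_t(a) f_t(x)` has variance zero: each subprocess is almost
surely equivariant (`ae_iter_eq_dftChar_mul`). Hence `V = N F U` for `f = ∑ f_t`, and `FᴴF = N⁻¹`
turns this into `U = FᴴV` (`ae_inducingU_eq`). Since `∑ k_t = k`, the sum has the law of the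
original process (`map_sum_pi_eq`).

Conditioning on `V` is therefore conditioning on `U`. Drawing the `f_t` independently given `u =
Fᴴv` and summing disintegrates the prior along `V` (`pi_compProd_sumKernel`), and does so
continuously in `v`. The law of `V` has full support because its covariance is nonsingular, so this
kernel agrees with `p(f | V)` at every `v` (`IsConditionalLaw.eq_of_continuous`). Almost every `v`
would not suffice: for singular `S_v` the variational law may live on a prior-null set. Pushing the
Gaussian law of `V` through `Fᴴ` then identifies the two mixtures. -/

namespace HVGP

/-! ### Characteristic functions on `ℂ^ι` -/

section CharFun

variable {ι κ : Type*} [Fintype ι] [Fintype κ]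

/-- The real linear form `z ↦ Re (wᴴ z)` on `ℂ^ι`. -/
noncomputable def reForm (w : ι → ℂ) : StrongDual ℝ (ι → ℂ) :=
  ∑ i, (Complex.reCLM.comp ((ContinuousLinearMap.mul ℝ ℂ (star (w i))).comp
    (ContinuousLinearMap.proj i)))

lemma reForm_eq_sum (w z : ι → ℂ) : reForm w z = ∑ i, (star (w i) * z i).re := by
  simp [reForm]

lemma reForm_apply (w z : ι → ℂ) : reForm w z = (star w ⬝ᵥ z).re := by
  simp [reForm_eq_sum, dotProduct, Complex.re_sum]

lemma reForm_mulVec (w : ι → ℂ) (A : Matrix ι κ ℂ) (z : κ → ℂ) :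
    reForm w (A *ᵥ z) = reForm (Aᴴ *ᵥ w) z := by
  rw [reForm_apply, reForm_apply, star_mulVec, conjTranspose_conjTranspose, dotProduct_mulVec]

/-- A real functional is fixed by its values on `e_i` and `i e_i`. Characteristic functions thus
need testing only on `reForm`, where matrices act through their adjoints. -/
lemma exists_eq_reForm (L : StrongDual ℝ (ι → ℂ)) : ∃ w, L = reForm w := by
  classical
  refine ⟨fun i => ⟨L (Pi.single i 1), L (Pi.single i Complex.I)⟩, ?_⟩
  ext z
  rw [reForm_eq_sum]
  conv_lhs => rw [← Finset.univ_sum_single z, map_sum]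
  refine Finset.sum_congr rfl fun i _ => ?_
  have h : (Pi.single i (z i) : ι → ℂ) = (z i).re • (Pi.single i 1 : ι → ℂ)
      + (z i).im • (Pi.single i Complex.I : ι → ℂ) := by
    rw [← Pi.single_smul, ← Pi.single_smul, ← Pi.single_add]
    congr 1
    apply Complex.ext <;> simp
  rw [h, map_add, map_smul, map_smul]
  simp
  ring

lemma ext_of_charFunDual_reForm {μ ν : Measure (ι → ℂ)} [IsFiniteMeasure μ] [IsFiniteMeasure ν]
    (h : ∀ w, charFunDual μ (reForm w) = charFunDual ν (reForm w)) : μ = ν := by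
  refine Measure.ext_of_charFunDual (funext fun L => ?_)
  obtain ⟨w, rfl⟩ := exists_eq_reForm L
  exact h w

lemma charFunDual_reForm_map_affine (μ : Measure (κ → ℂ)) (b w : ι → ℂ) (A : Matrix ι κ ℂ) :
    charFunDual (μ.map fun z => b + A *ᵥ z) (reForm w)
      = Complex.exp (reForm w b * Complex.I) * charFunDual μ (reForm (Aᴴ *ᵥ w)) := by
  rw [charFunDual_apply, integral_map (by fun_prop) (by fun_prop), charFunDual_apply,
    ← integral_const_mul]
  refine integral_congr_ae (ae_of_all _ fun z => ?_)
  simp only [map_add, reForm_mulVec, Complex.ofReal_add, add_mul, Complex.exp_add]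

instance : IsProbabilityMeasure stdComplexGaussian :=
  Measure.isProbabilityMeasure_map (by
    have : Measurable fun p : ℝ × ℝ => (⟨p.1, p.2⟩ : ℂ) :=
      Complex.measurableEquivRealProd.symm.measurable
    exact this.aemeasurable)

lemma integral_exp_stdComplexGaussian (w : ℂ) :
    ∫ z, Complex.exp ((star w * z).re * Complex.I) ∂stdComplexGaussian
      = Complex.exp (-(star w * w) / 4) := by
  have hm : Measurable fun p : ℝ × ℝ => (⟨p.1, p.2⟩ : ℂ) :=
    Complex.measurableEquivRealProd.symm.measurable
  -- Variance `1/2` in each real coordinate produces the factor `1/4` in the exponent.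
  have hg : ∀ t : ℝ, ∫ x, Complex.exp (t * x * Complex.I) ∂(gaussianReal 0 (1 / 2))
      = Complex.exp (-(t ^ 2) / 4) := fun t => by
    rw [← charFun_apply_real, charFun_gaussianReal]
    congr 1
    simp
    ring
  rw [stdComplexGaussian, integral_map hm.aemeasurable (by fun_prop)]
  have : ∀ p : ℝ × ℝ, Complex.exp (((star w * (⟨p.1, p.2⟩ : ℂ)).re : ℝ) * Complex.I)
      = Complex.exp (w.re * p.1 * Complex.I) * Complex.exp (w.im * p.2 * Complex.I) := fun p => by
    rw [← Complex.exp_add]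
    congr 1
    simp
    ring
  simp_rw [this]
  rw [integral_prod_mul (fun x : ℝ => Complex.exp (w.re * x * Complex.I))
    (fun x : ℝ => Complex.exp (w.im * x * Complex.I)), hg, hg, ← Complex.exp_add]
  congr 1
  have : star w * w = (w.re : ℂ) ^ 2 + (w.im : ℂ) ^ 2 := by
    rw [Complex.star_def, mul_comm, Complex.mul_conj, Complex.normSq_apply]
    push_cast
    ring
  rw [this]
  ring

lemma charFunDual_pi_stdComplexGaussian (w : ι → ℂ) :
    charFunDual (Measure.pi fun _ : ι => stdComplexGaussian) (reForm w)
      = Complex.exp (-(star w ⬝ᵥ w) / 4) := by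
  simp_rw [charFunDual_apply, reForm_eq_sum, Complex.ofReal_sum, Finset.sum_mul, Complex.exp_sum]
  rw [integral_fintype_prod_eq_prod (fun i z => Complex.exp ((star (w i) * z).re * Complex.I))]
  simp_rw [integral_exp_stdComplexGaussian, ← Complex.exp_sum, dotProduct, ← Finset.sum_div,
    Finset.sum_neg_distrib, Pi.star_apply]

instance (μ : ι → ℂ) (S : Matrix ι ι ℂ) : IsProbabilityMeasure (complexGaussian μ S) := by
  unfold complexGaussian
  exact Measure.isProbabilityMeasure_map (by fun_prop)

lemma charFunDual_complexGaussian (μ : ι → ℂ) {S : Matrix ι ι ℂ} (hS : S.PosSemidef) (w : ι → ℂ) :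
    charFunDual (complexGaussian μ S) (reForm w)
      = Complex.exp (reForm w μ * Complex.I - (star w ⬝ᵥ S *ᵥ w) / 4) := by
  classical
  have h0 : (0 : Matrix ι ι ℂ) ≤ S := hS.nonneg
  unfold complexGaussian
  rw [charFunDual_reForm_map_affine, charFunDual_pi_stdComplexGaussian, ← Complex.exp_add,
    star_mulVec, conjTranspose_conjTranspose, ← dotProduct_mulVec, mulVec_mulVec,
    (CFC.sqrt_nonneg S).posSemidef.isHermitian.eq, CFC.sqrt_mul_sqrt_self S]
  congr 1
  ring

/-- Affine images of complex Gaussian laws are complex Gaussian. -/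
lemma complexGaussian_map_affine (μ : κ → ℂ) {S : Matrix κ κ ℂ} (hS : S.PosSemidef)
    (b : ι → ℂ) (A : Matrix ι κ ℂ) :
    (complexGaussian μ S).map (fun z => b + A *ᵥ z)
      = complexGaussian (b + A *ᵥ μ) (A * S * Aᴴ) := by
  have : IsProbabilityMeasure ((complexGaussian μ S).map fun z => b + A *ᵥ z) :=
    Measure.isProbabilityMeasure_map (by fun_prop)
  refine ext_of_charFunDual_reForm fun w => ?_
  rw [charFunDual_reForm_map_affine, charFunDual_complexGaussian _ hS,
    charFunDual_complexGaussian _ (hS.mul_mul_conjTranspose_same A), ← Complex.exp_add, map_add,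
    reForm_mulVec, star_mulVec, conjTranspose_conjTranspose, ← dotProduct_mulVec, mulVec_mulVec,
    mulVec_mulVec, Matrix.mul_assoc]
  congr 1
  push_cast
  ring

lemma complexGaussian_map_mulVec (μ : κ → ℂ) {S : Matrix κ κ ℂ} (hS : S.PosSemidef)
    (A : Matrix ι κ ℂ) :
    (complexGaussian μ S).map (fun z => A *ᵥ z) = complexGaussian (A *ᵥ μ) (A * S * Aᴴ) := by
  simpa using complexGaussian_map_affine μ hS 0 A

lemma complexGaussian_zero_right (μ : ι → ℂ) :
    complexGaussian μ (0 : Matrix ι ι ℂ) = Measure.dirac μ := by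
  refine ext_of_charFunDual_reForm fun w => ?_
  rw [charFunDual_complexGaussian _ PosSemidef.zero, charFunDual_dirac]
  simp

/-- Sums of independent centred complex Gaussian vectors are complex Gaussian. -/
lemma map_sum_pi_complexGaussian {τ : Type*} [Fintype τ] {S : τ → Matrix ι ι ℂ}
    (hS : ∀ t, (S t).PosSemidef) :
    (Measure.pi fun t => complexGaussian 0 (S t)).map (fun f => ∑ t, f t)
      = complexGaussian 0 (∑ t, S t) := by
  have : IsProbabilityMeasure
      ((Measure.pi fun t => complexGaussian 0 (S t)).map (fun f => ∑ t, f t)) :=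
    Measure.isProbabilityMeasure_map (by fun_prop)
  refine ext_of_charFunDual_reForm fun w => ?_
  rw [charFunDual_map_sum_pi_eq_prod, Finset.prod_apply,
    charFunDual_complexGaussian _ (Matrix.posSemidef_sum _ fun t _ => hS t)]
  simp_rw [charFunDual_complexGaussian _ (hS _), ← Complex.exp_sum]
  congr 1
  simp [Matrix.sum_mulVec, dotProduct_sum, Finset.sum_div]

/-- A nondegenerate complex Gaussian law has full support. -/
lemma isOpenPosMeasure_complexGaussian (μ : ι → ℂ) {S : Matrix ι ι ℂ} (hS : S.PosDef) :
    (complexGaussian μ S).IsOpenPosMeasure := by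
  classical
  have hne : (1 / 2 : NNReal) ≠ 0 := by norm_num
  have hr : (gaussianReal 0 (1 / 2)).IsOpenPosMeasure :=
    (gaussianReal_absolutelyContinuous' 0 hne).isOpenPosMeasure
  have hc : stdComplexGaussian.IsOpenPosMeasure := by
    refine Continuous.isOpenPosMeasure_map ?_ ?_
    · exact Complex.equivRealProdCLM.symm.continuous
    · exact Complex.equivRealProdCLM.symm.surjective
  have h0 : (0 : Matrix ι ι ℂ) ≤ S := hS.posSemidef.nonneg
  unfold complexGaussian
  refine Continuous.isOpenPosMeasure_map (by fun_prop) ?_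
  -- An invertible root makes the defining affine map surjective, so full support is transported.
  have hu : IsUnit (CFC.sqrt S) := by
    have := hS.isUnit
    rw [← CFC.sqrt_mul_sqrt_self S] at this
    exact isUnit_of_mul_isUnit_left this
  intro y
  obtain ⟨x, hx⟩ := Matrix.mulVec_surjective_iff_isUnit.2 hu (y - μ)
  exact ⟨x, by simp [hx]⟩

end CharFun

/-! ### Gaussian process laws -/

section GaussianProcess

variable {X ι : Type*} [Fintype ι] {k : X → X → ℂ} {P Q : Measure (X → ℂ)}

lemma IsKernel.posSemidef (hk : IsKernel k) (x : ι → X) : (kernelMatrix k x x).PosSemidef := by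
  classical
  exact (hk (Finset.univ.image x)).submatrix
    fun i => (⟨x i, Finset.mem_image_of_mem x (Finset.mem_univ i)⟩ : Finset.univ.image x)

lemma IsGPLaw.isProbabilityMeasure (hP : IsGPLaw k P) : IsProbabilityMeasure P := by
  have h := hP ∅
  have : IsProbabilityMeasure (P.map (Finset.restrict (π := fun _ : X => ℂ) ∅)) := by
    rw [h]
    infer_instance
  exact Measure.isProbabilityMeasure_of_map (Finset.restrict (π := fun _ : X => ℂ) ∅)

/-- Finite-dimensional marginals of a Gaussian process, at possibly repeated inputs. -/
lemma IsGPLaw.map_eval (hP : IsGPLaw k P) (hk : IsKernel k) (x : ι → X) :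
    P.map (fun f i => f (x i)) = complexGaussian 0 (kernelMatrix k x x) := by
  classical
  set I := Finset.univ.image x
  let e : ι → I := fun i => ⟨x i, Finset.mem_image_of_mem x (Finset.mem_univ i)⟩
  -- Row `i` selects the coordinate of `x i`; rows may repeat, which accounts for repeated inputs.
  let A : Matrix ι I ℂ := (1 : Matrix I I ℂ).submatrix e id
  have hA : (fun f : X → ℂ => fun i => f (x i)) = (fun z : I → ℂ => A *ᵥ z) ∘ I.restrict := by
    ext f i
    simp [A, mulVec, dotProduct, one_apply, e]
  rw [hA, ← Measure.map_map (by fun_prop) (by fun_prop), hP I,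
    complexGaussian_map_mulVec _ (hk I)]
  congr 1
  · simp
  · ext i j
    simp [A, mul_apply, one_apply, kernelMatrix, e]

/-- A finite measure on functions is determined by its finite-dimensional marginals. -/
lemma ext_of_map_restrict [IsFiniteMeasure P]
    (h : ∀ I : Finset X, P.map I.restrict = Q.map I.restrict) : P = Q :=
  IsProjectiveLimit.unique (P := fun I : Finset X => P.map I.restrict) (fun _ => rfl)
    fun I => (h I).symm

/-- If the variance of `f x - c * f y` vanishes, then `f x = c * f y` almost surely. -/
lemma IsGPLaw.ae_eq_mul (hP : IsGPLaw k P) (hk : IsKernel k) {x y : X} {c : ℂ}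
    (h : k x x - star c * k x y - c * k y x + c * star c * k y y = 0) :
    ∀ᵐ f ∂P, f x = c * f y := by
  -- This row sends `(f x, f y)` to `f x - c * f y`, whose law is Gaussian with zero covariance,
  -- hence a point mass.
  let A : Matrix (Fin 1) (Fin 2) ℂ := !![1, -c]
  have hmeas : Measurable ((fun z => A *ᵥ z) ∘ fun (f : X → ℂ) i => f (![x, y] i)) :=
    Measurable.comp (by fun_prop) (by fun_prop)
  have hm : P.map ((fun z => A *ᵥ z) ∘ fun (f : X → ℂ) i => f (![x, y] i)) = Measure.dirac 0 := by
    rw [← Measure.map_map (by fun_prop) (by fun_prop), hP.map_eval hk, complexGaussian_map_mulVec _ (hk.posSemidef _),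
      ← complexGaussian_zero_right]
    congr 1
    · simp
    · ext i j
      fin_cases i; fin_cases j
      have h2 : (A * kernelMatrix k ![x, y] ![x, y] * Aᴴ) 0 0
          = k x x - c * k y x - (k x y - c * k y y) * star c := by
        simp [A, mul_apply, kernelMatrix, Fin.sum_univ_two, of_apply, -cons_mul]
        ring
      exact h2.trans (by rw [Matrix.zero_apply]; linear_combination h)
  have hae := (ae_dirac_iff (p := fun z => z = (0 : Fin 1 → ℂ)) (measurableSet_singleton 0)).2 rfl
  rw [← hm] at hae
  filter_upwards [ae_of_ae_map hmeas.aemeasurable hae] with f hf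
  have := congrFun hf 0
  simp [A, dotProduct, Fin.sum_univ_two] at this
  linear_combination this

lemma map_restrict_map_sum_pi {X τ : Type*} [Fintype τ] (Q : τ → Measure (X → ℂ))
    [∀ t, IsProbabilityMeasure (Q t)] (I : Finset X) :
    ((Measure.pi Q).map fun f => ∑ t, f t).map I.restrict
      = (Measure.pi fun t => (Q t).map I.restrict).map fun f => ∑ t, f t := by
  have h : (I.restrict ∘ fun f : τ → X → ℂ => ∑ t, f t)
      = (fun f : τ → I → ℂ => ∑ t, f t) ∘ fun f t => I.restrict (f t) := by
    ext f i
    simp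
  rw [Measure.map_map (by fun_prop) (by fun_prop), h,
    ← Measure.map_map (by fun_prop) (by fun_prop), Measure.pi_map_pi (by fun_prop)]

/-- The sum of independent Gaussian processes is a Gaussian process. -/
lemma isGPLaw_map_sum {τ : Type*} [Fintype τ] {ks : τ → X → X → ℂ} {Ps : τ → Measure (X → ℂ)}
    (hks : ∀ t, IsKernel (ks t)) (hPs : ∀ t, IsGPLaw (ks t) (Ps t)) :
    IsGPLaw (fun x y => ∑ t, ks t x y) ((Measure.pi Ps).map fun f => ∑ t, f t) := by
  intro I
  have := fun t => (hPs t).isProbabilityMeasure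
  have hK : kernelMatrix (fun x y => ∑ t, ks t x y) (fun i : I => (i : X)) (fun i : I => (i : X))
      = ∑ t, kernelMatrix (ks t) (fun i : I => (i : X)) (fun i : I => (i : X)) := by
    ext i j
    simp [kernelMatrix, Matrix.sum_apply]
  rw [map_restrict_map_sum_pi, hK, ← map_sum_pi_complexGaussian fun t => hks t I]
  simp_rw [hPs _ I]

lemma IsGPLaw.unique (hP : IsGPLaw k P) (hQ : IsGPLaw k Q) : P = Q := by
  have := hP.isProbabilityMeasure
  exact ext_of_map_restrict fun I => (hP I).trans (hQ I).symm

end GaussianProcess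

/-! ### Compositions of commuting cyclic maps -/

section Iter

variable {X : Type*}

/-- `G₁^{n₁} ∘ ⋯ ∘ G_J^{n_J}` for arbitrary exponents. -/
def iterNat {J : ℕ} (G : Fin J → X → X) (n : Fin J → ℕ) : X → X :=
  (List.ofFn fun j => (G j)^[n j]).foldr (fun g h => g ∘ h) id

lemma iterNat_succ {J : ℕ} (G : Fin (J + 1) → X → X) (n : Fin (J + 1) → ℕ) :
    iterNat G n = (G 0)^[n 0] ∘ iterNat (fun j => G j.succ) fun j => n j.succ := by
  simp [iterNat, List.ofFn_succ]

lemma iterNat_commute {J : ℕ} {G : Fin J → X → X} {g : X → X}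
    (h : ∀ j, Function.Commute g (G j)) (n : Fin J → ℕ) : Function.Commute g (iterNat G n) := by
  induction J with
  | zero => simpa [iterNat] using Function.Commute.id_right
  | succ J ih =>
    rw [iterNat_succ]
    exact ((h 0).iterate_right _).comp_right (ih (fun j => h j.succ) _)

lemma iterNat_add {J : ℕ} {G : Fin J → X → X} (h : ∀ i j, Function.Commute (G i) (G j))
    (n n' : Fin J → ℕ) : iterNat G (n + n') = iterNat G n ∘ iterNat G n' := by
  induction J with
  | zero => simp [iterNat]
  | succ J ih =>
    have hc := iterNat_commute (g := (G 0)^[n' 0]) (G := fun j : Fin J => G j.succ)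
      (fun j => (h 0 j.succ).iterate_left _) fun j => n j.succ
    ext x
    have e := ih (G := fun j => G j.succ) (fun i j => h _ _) (fun j => n j.succ)
      fun j => n' j.succ
    simp only [iterNat_succ, Function.comp_apply, Pi.add_apply, Function.iterate_add_apply]
    rw [← hc]
    exact congrArg _ (congrArg _ (congrFun e x))

lemma iterNat_invariant {J : ℕ} {G : Fin J → X → X} {k : X → X → ℂ}
    (hinv : ∀ j x x', k (G j x) (G j x') = k x x') (n : Fin J → ℕ) (x x' : X) :
    k (iterNat G n x) (iterNat G n x') = k x x' := by
  have hit : ∀ (g : X → X), (∀ x x', k (g x) (g x') = k x x') → ∀ (n : ℕ) x x',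
      k (g^[n] x) (g^[n] x') = k x x' := by
    intro g hg n
    induction n with
    | zero => simp
    | succ n ih => intro x x'; rw [Function.iterate_succ_apply, Function.iterate_succ_apply, ih, hg]
  induction J with
  | zero => simp [iterNat]
  | succ J ih =>
    rw [iterNat_succ]
    simp only [Function.comp_apply]
    rw [hit _ (hinv 0), ih fun j => hinv j.succ]

variable {J : ℕ} {T : Fin J → ℕ} {G : Fin J → X → X}

/-- Full periods act trivially; this matches the modular addition of `MultiIndex T` with
composition. -/
lemma iterNat_mod (hG : ∀ j, IsCyclicMap (T j) (G j)) (n : Fin J → ℕ) :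
    iterNat G (fun j => n j % T j) = iterNat G n := by
  unfold iterNat
  congr 2
  ext j : 1
  conv_rhs => rw [← Nat.mod_add_div (n j) (T j), Function.iterate_add, Function.iterate_mul,
    (hG j).1.2, Function.iterate_id, Function.comp_id]

lemma iter_zero [∀ j, NeZero (T j)] : iter (T := T) G 0 = id := by
  have : ∀ J (G : Fin J → X → X), iterNat G 0 = id := by
    intro J
    induction J with
    | zero => intro G; simp [iterNat]
    | succ J ih => intro G; rw [iterNat_succ]; exact ih _
  exact this J G

lemma iter_add [∀ j, NeZero (T j)] (hG : ∀ j, IsCyclicMap (T j) (G j))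
    (hcomm : ∀ i j x, G i (G j x) = G j (G i x)) (s t : MultiIndex T) (x : X) :
    iter G (s + t) x = iter G s (iter G t x) :=
  (congrFun (iterNat_mod hG fun j => (s j : ℕ) + t j) x).trans
    (congrFun (iterNat_add (fun i j x => hcomm i j x) (fun j => (s j : ℕ)) fun j => t j) x)

lemma kernel_iter {k : X → X → ℂ} (hinv : ∀ j x x', k (G j x) (G j x') = k x x')
    (t : MultiIndex T) (x x' : X) : k (iter G t x) (iter G t x') = k x x' :=
  iterNat_invariant hinv _ x x'

end Iter

/-! ### The discrete Fourier transform -/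

section Dft

/-- The root of unity `exp(-2πi / N)`. -/
noncomputable def dftRoot (N : ℕ) : ℂ := Complex.exp (-(2 * Real.pi * Complex.I / N))

lemma isPrimitiveRoot_dftRoot {N : ℕ} (hN : N ≠ 0) : IsPrimitiveRoot (dftRoot N) N := by
  rw [dftRoot, Complex.exp_neg]
  exact (Complex.isPrimitiveRoot_exp N hN).inv

lemma star_dftRoot_mul (N : ℕ) : star (dftRoot N) * dftRoot N = 1 := by
  rw [dftRoot, Complex.star_def, ← Complex.exp_conj, ← Complex.exp_add, Complex.exp_eq_one_iff]
  exact ⟨0, by simp [map_ofNat, neg_div]⟩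

lemma dft_apply (N : ℕ) (t s : Fin N) : dft N t s = (1 / (N : ℂ)) * dftRoot N ^ ((t : ℕ) * s) := by
  rw [dft, of_apply, dftRoot, ← Complex.exp_nat_mul]
  congr 2
  push_cast
  ring

/-- Each entry is a geometric sum whose ratio is an `N`-th root of unity, equal to `1` only on the
diagonal. The factor `1/N` remains because the matrix is normalised by `1/N` rather than `1/√N`. -/
lemma conjTranspose_dft_mul_dft {N : ℕ} (hN : N ≠ 0) : (dft N)ᴴ * dft N = (1 / (N : ℂ)) • 1 := by
  have hN' : (N : ℂ) ≠ 0 := Nat.cast_ne_zero.2 hN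
  have hz := isPrimitiveRoot_dftRoot hN
  ext s t
  have hterm : ∀ r : Fin N, star (dft N r s) * dft N r t
      = (1 / (N : ℂ)) ^ 2 * (star (dftRoot N) ^ (s : ℕ) * dftRoot N ^ (t : ℕ)) ^ (r : ℕ) := fun r => by
    rw [dft_apply, dft_apply, star_mul', star_pow, mul_pow, ← pow_mul, ← pow_mul, mul_comm (r : ℕ),
      mul_comm (r : ℕ)]
    simp
    ring
  simp_rw [mul_apply, conjTranspose_apply, hterm, ← Finset.mul_sum]
  rw [Fin.sum_univ_eq_sum_range
    (fun r => (star (dftRoot N) ^ (s : ℕ) * dftRoot N ^ (t : ℕ)) ^ r) N]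
  by_cases hst : s = t
  · subst hst
    rw [← mul_pow, star_dftRoot_mul]
    simp
    field_simp
  · have hne : star (dftRoot N) ^ (s : ℕ) * dftRoot N ^ (t : ℕ) ≠ 1 := fun h => hst <| by
      have h2 : dftRoot N ^ (t : ℕ) = dftRoot N ^ (s : ℕ) := by
        calc dftRoot N ^ (t : ℕ)
            = (star (dftRoot N) * dftRoot N) ^ (s : ℕ) * dftRoot N ^ (t : ℕ) := by
              rw [star_dftRoot_mul, one_pow, one_mul]
          _ = dftRoot N ^ (s : ℕ) * (star (dftRoot N) ^ (s : ℕ) * dftRoot N ^ (t : ℕ)) := by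
              rw [mul_pow]; ring
          _ = dftRoot N ^ (s : ℕ) := by rw [h, mul_one]
      exact (Fin.ext (hz.pow_inj t.2 s.2 h2)).symm
    have hone : (star (dftRoot N) ^ (s : ℕ) * dftRoot N ^ (t : ℕ)) ^ N = 1 := by
      rw [mul_pow, ← pow_mul, ← pow_mul, mul_comm _ N, mul_comm _ N, pow_mul, pow_mul, ← star_pow,
        hz.pow_eq_one]
      simp
    rw [geom_sum_eq hne, hone]
    simp [hst]

variable {J : ℕ} {T : Fin J → ℕ}

/-- The character `s ↦ exp(-2πi ∑ⱼ tⱼ sⱼ / Tⱼ)`. -/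
noncomputable def dftChar (t s : MultiIndex T) : ℂ := ∏ j, dftRoot (T j) ^ ((t j : ℕ) * s j)

lemma dftChar_comm (t s : MultiIndex T) : dftChar t s = dftChar s t := by
  simp_rw [dftChar, mul_comm]

lemma star_dftChar_mul (t s : MultiIndex T) : star (dftChar t s) * dftChar t s = 1 := by
  simp_rw [dftChar, star_prod, ← Finset.prod_mul_distrib, star_pow, ← mul_pow, star_dftRoot_mul,
    one_pow, Finset.prod_const_one]

lemma multiDft_apply (t s : MultiIndex T) :
    multiDft T t s = (1 / (∏ j, T j : ℕ) : ℂ) * dftChar t s := by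
  simp [multiDft, dft_apply, dftChar, Finset.prod_mul_distrib]

lemma dftChar_add [∀ j, NeZero (T j)] (t a b : MultiIndex T) :
    dftChar t (a + b) = dftChar t a * dftChar t b := by
  simp_rw [dftChar, ← Finset.prod_mul_distrib]
  refine Finset.prod_congr rfl fun j _ => ?_
  rw [← pow_add, ← mul_add, mul_comm (t j : ℕ), mul_comm (t j : ℕ), pow_mul, pow_mul, Pi.add_apply,
    Fin.val_add]
  congr 1
  conv_rhs => rw [← Nat.mod_add_div ((a j : ℕ) + b j) (T j), pow_add, pow_mul _ (T j),
    (isPrimitiveRoot_dftRoot (NeZero.ne (T j))).pow_eq_one, one_pow, mul_one]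

lemma conjTranspose_multiDft_mul_multiDft (hT : ∀ j, T j ≠ 0) :
    (multiDft T)ᴴ * multiDft T = (1 / (∏ j, T j : ℕ) : ℂ) • 1 := by
  ext s t
  have h : ∀ j, ∑ r, star (dft (T j) r (s j)) * dft (T j) r (t j)
      = (1 / (T j : ℂ)) * if s j = t j then 1 else 0 := fun j => by
    have := congrFun (congrFun (conjTranspose_dft_mul_dft (hT j)) (s j)) (t j)
    simpa [mul_apply, one_apply] using this
  simp only [mul_apply, conjTranspose_apply, multiDft, of_apply, star_prod,
    ← Finset.prod_mul_distrib]
  rw [← Fintype.piFinset_univ, ← Finset.prod_univ_sum (fun _ => Finset.univ)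
    (fun j r => star (dft (T j) r (s j)) * dft (T j) r (t j))]
  simp_rw [h, Finset.prod_mul_distrib]
  by_cases hst : s = t
  · subst hst
    simp
  · obtain ⟨j, hj⟩ := Function.ne_iff.1 hst
    rw [Finset.prod_eq_zero (f := fun j => if s j = t j then (1 : ℂ) else 0) (Finset.mem_univ j)
      (if_neg hj)]
    simp [hst]

/-- This is row `0` of the orthogonality relation, as `χ_t(0) = 1`. -/
lemma sum_multiDft_left [∀ j, NeZero (T j)] (s : MultiIndex T) :
    ∑ t, multiDft T t s = if s = 0 then 1 else 0 := by
  have hT := fun j => NeZero.ne (T j)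
  have hN : ((∏ j, T j : ℕ) : ℂ) ≠ 0 := Nat.cast_ne_zero.2 (Finset.prod_ne_zero_iff.2 fun j _ => hT j)
  have h := congrFun (congrFun (conjTranspose_multiDft_mul_multiDft hT) 0) s
  have h0 : ∀ t : MultiIndex T, star (multiDft T t 0) = 1 / (∏ j, T j : ℕ) := fun t => by
    simp [multiDft_apply, dftChar]
  simp_rw [mul_apply, conjTranspose_apply, h0, ← Finset.mul_sum] at h
  rw [Matrix.smul_apply, smul_eq_mul] at h
  rw [mul_left_cancel₀ (one_div_ne_zero hN) h, one_apply]
  simp [eq_comm]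

end Dft

/-! ### The kernel Fourier series -/

section FourierKernel

variable {X : Type*} {J : ℕ} {T : Fin J → ℕ} {G : Fin J → X → X} {k : X → X → ℂ}

lemma IsCyclicMap.ne_zero {N : ℕ} {g : X → X} (h : IsCyclicMap N g) : N ≠ 0 := h.1.1.ne'

lemma sum_fourierKernel (hG : ∀ j, IsCyclicMap (T j) (G j)) (x x' : X) :
    ∑ t, fourierKernel T G k t x x' = k x x' := by
  have := fun j => NeZero.mk (hG j).ne_zero
  simp_rw [fourierKernel]
  rw [Finset.sum_comm]
  simp_rw [← Finset.sum_mul, sum_multiDft_left]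
  simp [iter_zero]

/-- Translating the summation index by `a` in the finite group `MultiIndex T` releases a unimodular
factor. -/
lemma fourierKernel_iter_right (hG : ∀ j, IsCyclicMap (T j) (G j))
    (hcomm : ∀ i j x, G i (G j x) = G j (G i x)) (t a : MultiIndex T) (x x' : X) :
    fourierKernel T G k t x (iter G a x') = star (dftChar t a) * fourierKernel T G k t x x' := by
  have := fun j => NeZero.mk (hG j).ne_zero
  simp_rw [fourierKernel, ← iter_add hG hcomm]
  rw [Finset.mul_sum, ← Equiv.sum_comp (Equiv.addRight a) fun s => star (dftChar t a) *
    (multiDft T t s * k x (iter G s x'))]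
  refine Finset.sum_congr rfl fun s _ => ?_
  rw [Equiv.coe_addRight, multiDft_apply, multiDft_apply, dftChar_add]
  linear_combination -(1 / (∏ j, T j : ℕ) : ℂ) * dftChar t s * k x (iter G (s + a) x')
    * star_dftChar_mul t a

lemma fourierKernel_iter_left (hG : ∀ j, IsCyclicMap (T j) (G j))
    (hcomm : ∀ i j x, G i (G j x) = G j (G i x))
    (hinv : ∀ j x x', k (G j x) (G j x') = k x x') (t a : MultiIndex T) (x x' : X) :
    fourierKernel T G k t (iter G a x) x' = dftChar t a * fourierKernel T G k t x x' := by
  have := fun j => NeZero.mk (hG j).ne_zero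
  -- Joint invariance reduces a shift on the left to the inverse shift on the right.
  have h : fourierKernel T G k t (iter G a x) (iter G a x') = fourierKernel T G k t x x' := by
    simp_rw [fourierKernel, ← iter_add hG hcomm, add_comm _ a, iter_add hG hcomm, kernel_iter hinv]
  rw [fourierKernel_iter_right hG hcomm] at h
  linear_combination dftChar t a * h
    - fourierKernel T G k t (iter G a x) x' * star_dftChar_mul t a

lemma card_multiIndex : Fintype.card (MultiIndex T) = ∏ j, T j := by simp

/-- `k_t` is the covariance of the orbit average `∑_a conj(F_{t,a}) f(G^a x)`, so its Gram matrix
has the form `B K Bᴴ`. -/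
lemma isKernel_fourierKernel (hG : ∀ j, IsCyclicMap (T j) (G j))
    (hcomm : ∀ i j x, G i (G j x) = G j (G i x)) (hk : IsKernel k)
    (hinv : ∀ j x x', k (G j x) (G j x') = k x x') (t : MultiIndex T) :
    IsKernel (fourierKernel T G k t) := by
  classical
  intro I
  have hN : ((∏ j, T j : ℕ) : ℂ) ≠ 0 :=
    Nat.cast_ne_zero.2 (Finset.prod_ne_zero_iff.2 fun j _ => (hG j).ne_zero)
  let y : I × MultiIndex T → X := fun p => iter G p.2 p.1
  let B : Matrix I (I × MultiIndex T) ℂ :=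
    Matrix.of fun i p => if i = p.1 then star (multiDft T t p.2) else 0
  convert (hk.posSemidef y).mul_mul_conjTranspose_same B using 1
  ext i j
  have h1 : ∀ a : MultiIndex T, ∑ b, multiDft T t b * k (iter G a i) (iter G b j)
      = dftChar t a * fourierKernel T G k t i j :=
    fun a => fourierKernel_iter_left hG hcomm hinv t a i j
  have h2 : (B * kernelMatrix k y y * Bᴴ) i j
      = ∑ b, (∑ a, star (multiDft T t a) * k (iter G a i) (iter G b j)) * multiDft T t b := by
    simp [B, mul_apply, Fintype.sum_prod_type, kernelMatrix, y, apply_ite]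
  rw [h2]
  simp_rw [Finset.sum_mul]
  rw [Finset.sum_comm]
  -- The phases cancel, so all `N` values of `a` contribute the same `k_t / N`.
  have h3 : ∀ a : MultiIndex T, ∑ b, star (multiDft T t a) * k (iter G a i) (iter G b j)
      * multiDft T t b = (1 / (∏ j, T j : ℕ) : ℂ) * fourierKernel T G k t i j := fun a => by
    calc _ = star (multiDft T t a) * (dftChar t a * fourierKernel T G k t i j) := by
          rw [← h1, Finset.mul_sum]
          exact Finset.sum_congr rfl fun b _ => by ring
      _ = _ := by
          rw [multiDft_apply, star_mul']
          have : star (1 / (∏ j, T j : ℕ) : ℂ) = 1 / (∏ j, T j : ℕ) := by simp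
          rw [this]
          linear_combination (1 / (∏ j, T j : ℕ) : ℂ) * fourierKernel T G k t i j
            * star_dftChar_mul t a
  simp_rw [h3]
  rw [Finset.sum_const, Finset.card_univ, card_multiIndex, nsmul_eq_mul, ← mul_assoc,
    mul_one_div_cancel hN, one_mul]
  rfl

/-- Sample paths of the subprocess with kernel `k_t` satisfy `f_t ∘ G^a = χ_t(a) f_t`. -/
lemma ae_iter_eq_dftChar_mul (hG : ∀ j, IsCyclicMap (T j) (G j))
    (hcomm : ∀ i j x, G i (G j x) = G j (G i x)) (hk : IsKernel k)
    (hinv : ∀ j x x', k (G j x) (G j x') = k x x') {t : MultiIndex T} {P : Measure (X → ℂ)}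
    (hP : IsGPLaw (fourierKernel T G k t) P) (a : MultiIndex T) (x : X) :
    ∀ᵐ f ∂P, f (iter G a x) = dftChar t a * f x := by
  refine hP.ae_eq_mul (isKernel_fourierKernel hG hcomm hk hinv t) ?_
  rw [fourierKernel_iter_left hG hcomm hinv, fourierKernel_iter_left hG hcomm hinv,
    fourierKernel_iter_right hG hcomm]
  ring

end FourierKernel

/-! ### The additive prior -/

section AdditivePrior

variable {X : Type*} {J m : ℕ} {T : Fin J → ℕ} {G : Fin J → X → X} {k : X → X → ℂ}
  {Ps : MultiIndex T → Measure (X → ℂ)}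

lemma map_sum_pi_eq (hG : ∀ j, IsCyclicMap (T j) (G j))
    (hcomm : ∀ i j x, G i (G j x) = G j (G i x)) (hk : IsKernel k)
    (hinv : ∀ j x x', k (G j x) (G j x') = k x x') {P : Measure (X → ℂ)} (hP : IsGPLaw k P)
    (hPs : ∀ t, IsGPLaw (fourierKernel T G k t) (Ps t)) :
    (Measure.pi Ps).map (fun f => ∑ t, f t) = P := by
  have h := isGPLaw_map_sum (isKernel_fourierKernel hG hcomm hk hinv) hPs
  simp_rw [sum_fourierKernel hG] at h
  exact h.unique hP

lemma isUnit_conjTranspose_multiDft (hT : ∀ j, T j ≠ 0) : IsUnit (multiDft T)ᴴ := by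
  have hN : ((∏ j, T j : ℕ) : ℂ) ≠ 0 :=
    Nat.cast_ne_zero.2 (Finset.prod_ne_zero_iff.2 fun j _ => hT j)
  refine IsUnit.of_mul_eq_one (((∏ j, T j : ℕ) : ℂ) • multiDft T) ?_
  rw [Matrix.mul_smul, conjTranspose_multiDft_mul_multiDft hT, smul_smul, mul_one_div_cancel hN, one_smul]

lemma bijective_conjTranspose_multiDft_mul (hT : ∀ j, T j ≠ 0) :
    Function.Bijective (fun V : Matrix (MultiIndex T) (Fin m) ℂ => (multiDft T)ᴴ * V) := by
  have hu := (Matrix.isUnit_iff_isUnit_det _).1 (isUnit_conjTranspose_multiDft hT)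
  exact Function.bijective_iff_has_inverse.2 ⟨fun U => ((multiDft T)ᴴ)⁻¹ * U,
    fun V => nonsing_inv_mul_cancel_left _ _ hu, fun V => mul_nonsing_inv_cancel_left _ _ hu⟩

lemma ae_inducingU_eq (hG : ∀ j, IsCyclicMap (T j) (G j))
    (hcomm : ∀ i j x, G i (G j x) = G j (G i x)) (hk : IsKernel k)
    (hinv : ∀ j x x', k (G j x) (G j x') = k x x') (Z : Fin m → X)
    (hPs : ∀ t, IsGPLaw (fourierKernel T G k t) (Ps t)) :
    ∀ᵐ f ∂(Measure.pi Ps),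
      inducingU T Z f = (multiDft T)ᴴ * inducingV T G Z (∑ t, f t) := by
  have := fun t => (hPs t).isProbabilityMeasure
  have hT := fun j => (hG j).ne_zero
  have hN : ((∏ j, T j : ℕ) : ℂ) ≠ 0 :=
    Nat.cast_ne_zero.2 (Finset.prod_ne_zero_iff.2 fun j _ => hT j)
  have h : ∀ᵐ f ∂(Measure.pi Ps), ∀ (t a : MultiIndex T) (i : Fin m),
      f t (iter G a (Z i)) = dftChar t a * f t (Z i) := by
    simp_rw [ae_all_iff]
    exact fun t a i => (Measure.quasiMeasurePreserving_eval Ps t).ae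
      (ae_iter_eq_dftChar_mul hG hcomm hk hinv (hPs t) a (Z i))
  filter_upwards [h] with f hf
  -- `V_{s,i} = ∑_t χ_t(s) U_{t,i}`, and `χ_t(s) = χ_s(t)` makes this `N F U`.
  have hV : inducingV T G Z (∑ t, f t)
      = ((∏ j, T j : ℕ) : ℂ) • (multiDft T * inducingU T Z f) := by
    ext s i
    simp only [inducingV, inducingU, of_apply, Finset.sum_apply, hf, Matrix.smul_apply, mul_apply,
      multiDft_apply, smul_eq_mul, Finset.mul_sum]
    refine Finset.sum_congr rfl fun t _ => ?_
    rw [dftChar_comm s t]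
    field_simp
  rw [hV, Matrix.mul_smul, ← Matrix.mul_assoc, conjTranspose_multiDft_mul_multiDft hT, Matrix.smul_mul,
    Matrix.one_mul, smul_smul, mul_one_div_cancel hN, one_smul]

end AdditivePrior

/-! ### Products of Markov kernels -/

section PiKernel

variable {τ : Type*} [Fintype τ] {Ω E : τ → Type*} [∀ t, MeasurableSpace (Ω t)]
  [∀ t, MeasurableSpace (E t)]

lemma measurable_pi_kernel (κ : ∀ t, Kernel (Ω t) (E t)) [∀ t, IsMarkovKernel (κ t)] :
    Measurable fun u : ∀ t, Ω t => Measure.pi fun t => κ t (u t) := by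
  refine Measurable.measure_of_isPiSystem_of_isProbabilityMeasure generateFrom_pi.symm
    isPiSystem_pi ?_
  rintro _ ⟨s, hs, rfl⟩
  simp_rw [Measure.pi_pi]
  exact Finset.measurable_prod _ fun t _ =>
    ((κ t).measurable_coe (hs t (Set.mem_univ t))).comp (measurable_pi_apply t)

/-- The product kernel `u ↦ ⨂ₜ κ_t(u_t)`. -/
noncomputable def piKernel (κ : ∀ t, Kernel (Ω t) (E t)) [∀ t, IsMarkovKernel (κ t)] :
    Kernel (∀ t, Ω t) (∀ t, E t) :=
  ⟨fun u => Measure.pi fun t => κ t (u t), measurable_pi_kernel κ⟩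

lemma piKernel_apply (κ : ∀ t, Kernel (Ω t) (E t)) [∀ t, IsMarkovKernel (κ t)] (u : ∀ t, Ω t) :
    piKernel κ u = Measure.pi fun t => κ t (u t) := rfl

instance (κ : ∀ t, Kernel (Ω t) (E t)) [∀ t, IsMarkovKernel (κ t)] :
    IsMarkovKernel (piKernel κ) :=
  ⟨fun u => by rw [piKernel_apply]; infer_instance⟩

lemma lintegral_pi_prod (μ : ∀ t, Measure (Ω t)) [∀ t, IsProbabilityMeasure (μ t)]
    {g : ∀ t, Ω t → ENNReal} (hg : ∀ t, Measurable (g t)) :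
    ∫⁻ u, ∏ t, g t (u t) ∂(Measure.pi μ) = ∏ t, ∫⁻ x, g t x ∂(μ t) := by
  rw [lintegral_prod_eq_prod_lintegral_of_indepFun Finset.univ (fun t (u : ∀ t, Ω t) => g t (u t))
    (iIndepFun_pi fun t => (hg t).aemeasurable) fun t => (hg t).comp (measurable_pi_apply t)]
  exact Finset.prod_congr rfl fun t _ => (measurePreserving_eval μ t).lintegral_comp (hg t)

lemma pi_compProd (μ : ∀ t, Measure (Ω t)) [∀ t, IsProbabilityMeasure (μ t)]
    (κ : ∀ t, Kernel (Ω t) (E t)) [∀ t, IsMarkovKernel (κ t)] :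
    Measure.pi μ ⊗ₘ piKernel κ = (Measure.pi fun t => μ t ⊗ₘ κ t).map
      fun p => (fun t => (p t).1, fun t => (p t).2) := by
  have hz : Measurable fun (q : (∀ t, Ω t) × (∀ t, E t)) t => (q.1 t, q.2 t) := by fun_prop
  have h : Measure.pi (fun t => μ t ⊗ₘ κ t)
      = (Measure.pi μ ⊗ₘ piKernel κ).map fun q t => (q.1 t, q.2 t) := by
    -- On boxes the inner product measure factors, and then so does the integral over the base.
    refine Measure.pi_eq fun s hs => ?_
    rw [Measure.map_apply hz (.univ_pi hs), Measure.compProd_apply (hz (.univ_pi hs))]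
    simp_rw [Measure.compProd_apply (hs _)]
    rw [← lintegral_pi_prod μ fun t => Kernel.measurable_kernel_prodMk_left (hs t)]
    refine lintegral_congr fun u => ?_
    rw [piKernel_apply, ← Measure.pi_pi]
    rfl
  rw [h, Measure.map_map (by fun_prop) hz]
  exact Measure.map_id.symm

lemma map_compProd_eq {α β γ : Type*} [MeasurableSpace α] [MeasurableSpace β] [MeasurableSpace γ]
    (μ : Measure α) [SFinite μ] {g : α → β} (hg : Measurable g) (η : Kernel β γ)
    [IsSFiniteKernel η] :
    μ.map g ⊗ₘ η = (μ ⊗ₘ η.comap g hg).map (Prod.map g id) := by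
  ext s hs
  rw [Measure.compProd_apply hs, Measure.map_apply (by fun_prop) hs,
    Measure.compProd_apply (by measurability),
    lintegral_map (Kernel.measurable_kernel_prodMk_left hs) hg]
  rfl

end PiKernel

/-! ### Uniqueness of the weakly continuous conditional law -/

section ConditionalLaw

variable {X ι : Type*} [Fintype ι] {P : Measure (X → ℂ)} {Φ : (X → ℂ) → ι → ℂ}
  {κ : Kernel (ι → ℂ) (X → ℂ)}

/-- The cosine and sine of `L` are bounded continuous real test functions. -/
lemma IsConditionalLaw.continuous_charFunDual (hκ : IsConditionalLaw P Φ κ) (I : Finset X)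
    (L : StrongDual ℝ (I → ℂ)) :
    Continuous fun v => charFunDual ((κ v).map I.restrict) L := by
  have := hκ.isMarkovKernel
  let c : (I → ℂ) →ᵇ ℝ := .ofNormedAddCommGroup (fun z => Real.cos (L z)) (by fun_prop) 1
    fun z => Real.abs_cos_le_one _
  let s : (I → ℂ) →ᵇ ℝ := .ofNormedAddCommGroup (fun z => Real.sin (L z)) (by fun_prop) 1
    fun z => Real.abs_sin_le_one _
  have h : ∀ v, charFunDual ((κ v).map I.restrict) L
      = (∫ f, c (I.restrict f) ∂(κ v) : ℝ) + (∫ f, s (I.restrict f) ∂(κ v) : ℝ) * Complex.I := by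
    intro v
    have hi : ∀ g : (I → ℂ) →ᵇ ℝ, Integrable (fun f => g (I.restrict f)) (κ v) := fun g =>
      Integrable.of_bound (g.continuous.measurable.comp (by fun_prop)).aestronglyMeasurable ‖g‖
        (ae_of_all _ fun f => g.norm_coe_le_norm _)
    rw [charFunDual_apply, integral_map (by fun_prop) (by fun_prop), ← integral_complex_ofReal,
      ← integral_complex_ofReal, ← integral_mul_const,
      ← integral_add (hi c).ofReal ((hi s).ofReal.mul_const _)]
    refine integral_congr_ae (ae_of_all _ fun f => ?_)
    simp [c, s, Complex.exp_mul_I]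
  simp_rw [h]
  have hc := hκ.continuous I c
  have hs := hκ.continuous I s
  fun_prop

/-- If `Φ(f)` has full support, a kernel which disintegrates `P` along `Φ` and whose
finite-dimensional characteristic functions are continuous is the conditional law. -/
lemma IsConditionalLaw.eq_of_continuous (hκ : IsConditionalLaw P Φ κ) [IsFiniteMeasure P]
    (hΦ : (P.map Φ).IsOpenPosMeasure) {η : Kernel (ι → ℂ) (X → ℂ)} [IsMarkovKernel η]
    (hη : (P.map Φ) ⊗ₘ η = P.map fun f => (Φ f, f))
    (hc : ∀ (I : Finset X) (L : StrongDual ℝ (I → ℂ)),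
      Continuous fun v => charFunDual ((η v).map I.restrict) L) (v : ι → ℂ) :
    η v = κ v := by
  have := hκ.isMarkovKernel
  refine ext_of_map_restrict fun I => ?_
  have hr : Measurable (I.restrict (π := fun _ => ℂ)) := by fun_prop
  have hIη : IsMarkovKernel (η.map I.restrict) := Kernel.IsMarkovKernel.map _ hr
  have hIκ : IsMarkovKernel (κ.map I.restrict) := Kernel.IsMarkovKernel.map _ hr
  -- Uniqueness of disintegrations is applied to finite-dimensional marginals, since the path space
  -- over an uncountable `X` is not countably generated.
  have hae : η.map I.restrict =ᵐ[P.map Φ] κ.map I.restrict := by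
    refine Kernel.ae_eq_of_compProd_eq ?_
    rw [Measure.compProd_map hr, Measure.compProd_map hr, hη, hκ.disintegration]
  refine Measure.ext_of_charFunDual (funext fun L => ?_)
  -- Continuous functions that agree almost everywhere for a measure of full support agree
  -- everywhere.
  have hL := ((hc I L).ae_eq_iff_eq (P.map Φ) (hκ.continuous_charFunDual I L)).1 <| by
    filter_upwards [hae] with v hv
    rw [Kernel.map_apply _ hr, Kernel.map_apply _ hr] at hv
    rw [hv]
  exact congrFun hL v

end ConditionalLaw

/-! ### The harmonic posterior -/

section SumKernel

/-- The conditional law of `∑ₜ f_t` given `U = u`, for independent conditional laws `κ_t(u_t)`. -/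
noncomputable def sumKernel {X τ ι : Type*} [Fintype τ] (κ : τ → Kernel (ι → ℂ) (X → ℂ))
    [∀ t, IsMarkovKernel (κ t)] : Kernel (τ → ι → ℂ) (X → ℂ) :=
  (piKernel κ).map fun f => ∑ t, f t

variable {X τ ι : Type*} [Fintype τ] {κ : τ → Kernel (ι → ℂ) (X → ℂ)}

lemma sumKernel_apply [∀ t, IsMarkovKernel (κ t)] (u : τ → ι → ℂ) :
    sumKernel κ u = (Measure.pi fun t => κ t (u t)).map fun f => ∑ t, f t :=
  Kernel.map_apply _ (by fun_prop) _

instance [∀ t, IsMarkovKernel (κ t)] : IsMarkovKernel (sumKernel κ) :=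
  Kernel.IsMarkovKernel.map _ (by fun_prop)

lemma continuous_charFunDual_sumKernel [Fintype ι] [∀ t, IsMarkovKernel (κ t)] {Ps : τ → Measure (X → ℂ)}
    {Φ : (X → ℂ) → ι → ℂ} (hκ : ∀ t, IsConditionalLaw (Ps t) Φ (κ t)) (I : Finset X)
    (L : StrongDual ℝ (I → ℂ)) :
    Continuous fun u => charFunDual ((sumKernel κ u).map I.restrict) L := by
  have : ∀ (t : τ) (u : τ → ι → ℂ), IsProbabilityMeasure ((κ t (u t)).map I.restrict) :=
    fun t u => Measure.isProbabilityMeasure_map (by fun_prop)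
  simp_rw [sumKernel_apply, map_restrict_map_sum_pi, charFunDual_map_sum_pi_eq_prod,
    Finset.prod_apply]
  exact continuous_finsetProd _ fun t _ =>
    ((hκ t).continuous_charFunDual I L).comp (continuous_apply t)

lemma pi_compProd_sumKernel [Fintype ι] [∀ t, IsMarkovKernel (κ t)] {Ps : τ → Measure (X → ℂ)}
    [∀ t, IsProbabilityMeasure (Ps t)] {Φ : (X → ℂ) → ι → ℂ} (hΦ : Measurable Φ)
    (hκ : ∀ t, IsConditionalLaw (Ps t) Φ (κ t)) :
    (Measure.pi Ps).map (fun f t => Φ (f t)) ⊗ₘ sumKernel κ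
      = (Measure.pi Ps).map fun f => (fun t => Φ (f t), ∑ t, f t) := by
  have : ∀ t, IsProbabilityMeasure ((Ps t).map Φ) :=
    fun t => Measure.isProbabilityMeasure_map hΦ.aemeasurable
  have : ∀ t, IsProbabilityMeasure ((Ps t).map fun f => (Φ f, f)) :=
    fun t => Measure.isProbabilityMeasure_map (by fun_prop)
  rw [sumKernel, Measure.compProd_map (by fun_prop), Measure.pi_map_pi (by fun_prop),
    pi_compProd]
  simp_rw [(hκ _).disintegration]
  rw [← Measure.pi_map_pi (by fun_prop), Measure.map_map (by fun_prop) (by fun_prop),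
    Measure.map_map (by fun_prop) (by fun_prop)]
  rfl

end SumKernel

end HVGP

theorem theorem3 {X : Type*} {J m : ℕ} (T : Fin J → ℕ) (G : Fin J → X → X)
    (hG : ∀ j, IsCyclicMap (T j) (G j))
    (hcomm : ∀ i j x, G i (G j x) = G j (G i x))
    (k : X → X → ℂ) (hk : IsKernel k)
    (hinv : ∀ j x x', k (G j x) (G j x') = k x x')
    (Z : Fin m → X)
    -- the prior covariance matrix of `vec V` is nonsingular
    (hZ : (kernelMatrix k (fun a : Fin m × MultiIndex T => iter G a.2 (Z a.1))
      (fun a : Fin m × MultiIndex T => iter G a.2 (Z a.1))).PosDef)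
    -- the prior of `f`, and `p(f(·) | V)`
    (P : Measure (X → ℂ)) (hP : IsGPLaw k P)
    (κ : Kernel (Fin m × MultiIndex T → ℂ) (X → ℂ))
    (hκ : IsConditionalLaw P (fun f => vec (inducingV T G Z f)) κ)
    -- the priors of the subprocesses `f_t`, and `p_t(f_t(·) | u_t)`
    (Ps : MultiIndex T → Measure (X → ℂ))
    (hPs : ∀ t, IsGPLaw (fourierKernel T G k t) (Ps t))
    (κs : MultiIndex T → Kernel (Fin m → ℂ) (X → ℂ))
    (hκs : ∀ t, IsConditionalLaw (Ps t) (fun f i => f (Z i)) (κs t))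
    -- the variational parameters
    (M : Matrix (MultiIndex T) (Fin m) ℂ)
    (S : Matrix (Fin m × MultiIndex T) (Fin m × MultiIndex T) ℂ) (hS : S.PosSemidef) :
    -- the two variational posteriors have the same marginal law of `f(·)`
    harmonicMarginal T κs
        (complexGaussian (vec ((multiDft T)ᴴ * M))
          (((1 : Matrix (Fin m) (Fin m) ℂ) ⊗ₖ (multiDft T)ᴴ) * S *
            ((1 : Matrix (Fin m) (Fin m) ℂ) ⊗ₖ multiDft T))) =
      svgpMarginal κ (complexGaussian (vec M) S) ∧
    -- under the additive prior `f = ∑ₜ f_t`, with independent `f_t`, the process `f` has law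
    -- `GP(0, k)` and the inducing variables satisfy the bijective relation `U = Fᴴ V`
    ((Measure.pi Ps).map (fun f => ∑ t, f t) = P ∧
      (∀ᵐ f ∂(Measure.pi Ps), inducingU T Z f = (multiDft T)ᴴ * inducingV T G Z (∑ t, f t)) ∧
      Function.Bijective
        (fun V : Matrix (MultiIndex T) (Fin m) ℂ => (multiDft T)ᴴ * V)) := by
  have hT := fun j => (hG j).ne_zero
  have hsum := map_sum_pi_eq hG hcomm hk hinv hP hPs
  have hU := ae_inducingU_eq hG hcomm hk hinv Z hPs
  refine ⟨?_, hsum, hU, bijective_conjTranspose_multiDft_mul hT⟩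
  have := hP.isProbabilityMeasure
  have := fun t => (hPs t).isProbabilityMeasure
  have := fun t => (hκs t).isMarkovKernel
  set A : Matrix (Fin m × MultiIndex T) (Fin m × MultiIndex T) ℂ := 1 ⊗ₖ (multiDft T)ᴴ with hA
  have hAH : (1 : Matrix (Fin m) (Fin m) ℂ) ⊗ₖ multiDft T = Aᴴ := by
    rw [hA, conjTranspose_kronecker, conjTranspose_one, conjTranspose_conjTranspose]
  have hAu : IsUnit A.det := by
    rw [hA, det_kronecker, det_one, one_pow, one_mul]
    exact ((Matrix.isUnit_iff_isUnit_det _).1 (isUnit_conjTranspose_multiDft hT)).pow _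
  -- `R` takes `vec V` to the rows of `FᴴV`. As `vec` stacks columns, its index is `(i, t)`, and `A
  -- = 1 ⊗ Fᴴ` acts on `vec V` as left multiplication by `Fᴴ`.
  let R : (Fin m × MultiIndex T → ℂ) → MultiIndex T → Fin m → ℂ := fun v t i => (A *ᵥ v) (i, t)
  let R' : (MultiIndex T → Fin m → ℂ) → Fin m × MultiIndex T → ℂ :=
    fun u => A⁻¹ *ᵥ fun a => u a.2 a.1
  have hRc : Continuous R := by fun_prop
  have hR'c : Continuous R' := by fun_prop
  have hRR' : R ∘ R' = id := by
    ext u t i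
    simp [R, R', mulVec_mulVec, mul_nonsing_inv _ hAu]
  let Φ : (X → ℂ) → Fin m × MultiIndex T → ℂ := fun f => vec (inducingV T G Z f)
  have hΦ : Measurable Φ := by
    refine measurable_pi_lambda _ fun a => ?_
    exact measurable_pi_apply (iter G a.2 (Z a.1))
  let Ψ : (X → ℂ) → Fin m → ℂ := fun f i => f (Z i)
  have hΨ : Measurable Ψ := by fun_prop
  have hΦΨ : ∀ᵐ f ∂(Measure.pi Ps), Φ (∑ t, f t) = R' fun t => Ψ (f t) := by
    filter_upwards [hU] with f hf
    have h : (fun a : Fin m × MultiIndex T => Ψ (f a.2) a.1) = A *ᵥ Φ (∑ t, f t) := by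
      rw [hA, ← vec_mul_eq_mulVec, ← hf]
      rfl
    simp only [R']
    rw [h, mulVec_mulVec, nonsing_inv_mul _ hAu, one_mulVec]
  let η := (sumKernel κs).comap R hRc.measurable
  -- The disintegration along `U` under the additive prior is transported to `V` by `R'`, using `V =
  -- R' U` almost surely.
  have hη : P.map Φ ⊗ₘ η = P.map fun f => (Φ f, f) := by
    have hPΦ : P.map Φ = ((Measure.pi Ps).map fun f t => Ψ (f t)).map R' := by
      rw [← hsum, Measure.map_map hΦ (by fun_prop), Measure.map_map hR'c.measurable (by fun_prop)]
      exact Measure.map_congr hΦΨ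
    have hcomap : η.comap R' hR'c.measurable = sumKernel κs := by
      ext1 u
      simp only [η, Kernel.comap_apply]
      exact congrArg _ (congrFun hRR' u)
    rw [hPΦ, map_compProd_eq _ hR'c.measurable, hcomap, pi_compProd_sumKernel hΨ hκs,
      Measure.map_map (by fun_prop) (by fun_prop), ← hsum,
      Measure.map_map (by fun_prop) (by fun_prop)]
    refine Measure.map_congr ?_
    filter_upwards [hΦΨ] with f hf
    simp [hf]
  have hpos : (P.map Φ).IsOpenPosMeasure := by
    have h := hP.map_eval hk fun a : Fin m × MultiIndex T => iter G a.2 (Z a.1)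
    change P.map Φ = _ at h
    rw [h]
    exact isOpenPosMeasure_complexGaussian _ hZ
  have hηκ := hκ.eq_of_continuous hpos hη fun I L =>
    (continuous_charFunDual_sumKernel hκs I L).comp hRc
  rw [hAH, vec_mul_eq_mulVec, ← hA, ← complexGaussian_map_mulVec _ hS A]
  have hq : Measurable fun u : Fin m × MultiIndex T → ℂ =>
      (Measure.pi fun t => κs t fun i => u (i, t)).map fun f => ∑ t, f t := by
    refine (Measure.measurable_map _ (by fun_prop)).comp ((measurable_pi_kernel κs).comp ?_)
    fun_prop
  rw [harmonicMarginal, svgpMarginal, Measure.bind, Measure.bind,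
    Measure.map_map hq (by fun_prop)]
  -- Both sides are now mixtures over the same law of `v`, so the pointwise identity `η v = κ v`
  -- finishes.
  congr 2
  ext1 v
  rw [← hηκ v]
  exact (sumKernel_apply (κ := κs) (R v)).symm
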